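/- Let $R$ be a discrete valuation ring with field of fractions $K$ and perfect residue field $\kappa$. For an $R$-scheme $X$ write $X_K = X\times_R K$ and $X_\kappa = X\times_R\kappa$ for its generic and special fibres. For an irreducible component $C$ of $X_\kappa$ with generic point $\eta_C$, the multiplicity of $C$ is the length of the local ring $\mathcal{O}_{X_\kappa,\eta_C}$, the function field $\kappa(C)$ is the residue field of $X_\kappa$ at $\eta_C$ (that is, the function field of $C$ with its reduced structure), and $\kappa_C$ denotes the algebraic closure of $\kappa$ in $\kappa(C)$. Let $Y$ and $Y'$ be integral regular schemes that are proper over $R$, and assume that the generic fibre $Y_K$ is non-empty. Suppose that there is a dominant rational map of $K$-schemes from $Y_K$ to $Y'_K$. Then for every irreducible component $C\subset Y_\kappa$ of multiplicity $1$ there exists an irreducible component $C'\subset Y'_\kappa$ of multiplicity $1$ such that $\kappa_{C'}\subset\kappa_C$, in the sense that there is a homomorphism of $\kappa$-algebras $\kappa_{C'}\to\kappa_C$. -/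

import Mathlib

open CategoryTheory CategoryTheory.Limits AlgebraicGeometry

universe u

noncomputable section

namespace DVRFibres

/-- A scheme is regular if it is locally Noetherian and all its local rings are regular. -/
structure IsRegularScheme (X : Scheme.{u}) : Prop where
  isLocallyNoetherian : IsLocallyNoetherian X
  isRegularLocalRing_stalk : ∀ x : X, IsRegularLocalRing (X.presheaf.stalk x)

section BaseChange

variable {R : Type u} [CommRing R] {Y : Scheme.{u}}

/-- The base change `Y ×_R A` of an `R`-scheme `f : Y ⟶ Spec R` to an `R`-algebra `A`.
For `R` a discrete valuation ring this is the generic fibre when `A` is the fraction field,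
and the special fibre when `A` is the residue field. -/
def baseChange (f : Y ⟶ Spec (.of R)) (A : Type u) [CommRing A] [Algebra R A] : Scheme.{u} :=
  pullback f (Spec.map (CommRingCat.ofHom (algebraMap R A)))

/-- The structure morphism `Y ×_R A ⟶ Spec A` of the base change. -/
def baseChangeHom (f : Y ⟶ Spec (.of R)) (A : Type u) [CommRing A] [Algebra R A] :
    baseChange f A ⟶ Spec (.of A) :=
  pullback.snd f (Spec.map (CommRingCat.ofHom (algebraMap R A)))

end BaseChange

section Components

variable {X : Scheme.{u}}

/-- The generic point of an irreducible component `C` of `X`. -/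
def componentGenericPoint (C : irreducibleComponents X) : X :=
  IsIrreducible.genericPoint (S := (C : Set X)) C.2.1

/-- The multiplicity of an irreducible component `C` of `X`: the length of the local ring of `X`
at the generic point of `C`. -/
def componentMultiplicity (C : irreducibleComponents X) : ℕ∞ :=
  Module.length (X.presheaf.stalk (componentGenericPoint C))
    (X.presheaf.stalk (componentGenericPoint C))

variable {k : Type u} [Field k]

/-- The function field `k(C)` of an irreducible component `C` (with its reduced structure) of a
`k`-scheme `p : X ⟶ Spec k`, that is, the residue field of `X` at the generic point of `C`. The
structure morphism `p` is recorded because it gives the `k`-algebra structure. -/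
def componentFunctionField (_p : X ⟶ Spec (.of k)) (C : irreducibleComponents X) : Type u :=
  X.residueField (componentGenericPoint C)

instance (p : X ⟶ Spec (.of k)) (C : irreducibleComponents X) :
    Field (componentFunctionField p C) :=
  inferInstanceAs (Field (X.residueField (componentGenericPoint C)))

/-- The `k`-algebra structure on `k(C)` corresponds to the composite
`Spec k(C) ⟶ X ⟶ Spec k`. -/
instance (p : X ⟶ Spec (.of k)) (C : irreducibleComponents X) :
    Algebra k (componentFunctionField p C) :=
  RingHom.toAlgebra
    (Spec.preimage (X.fromSpecResidueField (componentGenericPoint C) ≫ p)).hom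

/-- The field `k_C`: the algebraic closure of `k` in the function field `k(C)`. -/
def constantField (p : X ⟶ Spec (.of k)) (C : irreducibleComponents X) :
    IntermediateField k (componentFunctionField p C) :=
  algebraicClosure k (componentFunctionField p C)

end Components

end DVRFibres

end

/-! ### Regular local rings: hyperplane sections and integrality -/

namespace IsRegularLocalRing

open IsLocalRing

/-! Let `η` be the generic point of `C` and `y` its image in `Y`. Multiplicity 1 means that the
special fibre has a field as local ring at `η`, so `π` generates the maximal ideal of the local ring
of `Y` at `y`, which is therefore a DVR with uniformizer `π`. The rational map gives a point of `Y'`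
in the function field of `Y`, and the valuative criterion yields an `R`-morphism from the spectrum
of this DVR to `Y'`. Restricted to the closed point, it is a `κ`-morphism from `Spec κ(C)` to the
special fibre of `Y'`, with image `x'` say.

The local homomorphism of stalks sends `π` to `π`. As `π` is not in the square of the maximal ideal
at `y`, it is not in the square of the one at `x'`, so the special fibre of `Y'` is regular at `x'`
(`quotient_span_singleton`, `ker_stalkMap_of_isPullback`). Hence its local ring there is a domain
(`isDomain`), whose fraction field is the local ring at the generic point of a component `C'`
through `x'`: the multiplicity of `C'` is 1.

Finally, algebraic extensions of `κ` inside the fraction field of a regular local `κ`-algebra embed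
in its residue field (`nonempty_algHom_of_algHom_fractionRing`): one descends through successive
hyperplane sections, using at each step that a DVR is integrally closed. So `κ_{C'}` maps to the
residue field at `x'`, thence to `κ(C)`, and lands in `κ_C` by algebraicity. -/

lemma exists_span_insert_eq_maximalIdeal {R : Type*} [CommRing R] [IsLocalRing R]
    [IsNoetherianRing R] {x : R} (hx : x ∈ maximalIdeal R) (hx2 : x ∉ maximalIdeal R ^ 2) :
    ∃ t : Finset R, t.card < (maximalIdeal R).spanFinrank ∧
      Ideal.span (insert x (t : Set R)) = maximalIdeal R := by
  classical
  obtain ⟨s, hs, hspan⟩ :=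
    Submodule.FG.exists_span_finset_card_eq_spanFinrank (maximalIdeal R).fg_of_isNoetherianRing
  have hsm : ∀ i ∈ s, i ∈ maximalIdeal R := fun i hi ↦ hspan ▸ Submodule.subset_span hi
  obtain ⟨a, -, ha⟩ := Submodule.mem_span_finset.mp (hspan ▸ hx : x ∈ Submodule.span R (s : Set R))
  -- Exchange argument: some coefficient of `x` on a minimal generating set is a unit, so `x` can
  -- replace that generator.
  obtain ⟨j, hj, hju⟩ : ∃ j ∈ s, a j ∉ maximalIdeal R := by
    by_contra! h
    exact hx2 (ha ▸ pow_two (maximalIdeal R) ▸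
      Ideal.sum_mem _ fun i hi ↦ Ideal.mul_mem_mul (h i hi) (hsm i hi))
  refine ⟨s.erase j, hs ▸ Finset.card_erase_lt_of_mem hj, le_antisymm ?_ ?_⟩
  · rw [Ideal.span_le]
    rintro y (rfl | hy)
    · exact hx
    · exact hsm y (Finset.mem_of_mem_erase hy)
  · conv_lhs => rw [← hspan]
    rw [Submodule.span_le]
    intro i hi
    by_cases hij : i = j
    · subst hij
      rw [mem_maximalIdeal, mem_nonunits_iff, not_not] at hju
      have : a i * i ∈ Ideal.span (insert x ((s.erase i : Finset R) : Set R)) := by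
        have h1 := Finset.add_sum_erase s (fun i ↦ a i • i) hj
        simp only [smul_eq_mul] at h1 ha
        rw [ha] at h1
        rw [eq_sub_of_add_eq h1]
        refine Ideal.sub_mem _ (Ideal.subset_span (Set.mem_insert _ _))
          (Ideal.sum_mem _ fun l hl ↦ Ideal.mul_mem_left _ _
            (Ideal.subset_span (Set.mem_insert_of_mem _ hl)))
      exact (Ideal.unit_mul_mem_iff_mem _ hju).mp this
    · exact Ideal.subset_span (Set.mem_insert_of_mem _ (Finset.mem_erase.mpr ⟨hij, hi⟩))

lemma isLocalRing_quotient_span_singleton {R : Type*} [CommRing R] [IsLocalRing R] {x : R}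
    (hx : x ∈ maximalIdeal R) : IsLocalRing (R ⧸ Ideal.span {x}) := by
  have : Nontrivial (R ⧸ Ideal.span {x}) := Ideal.Quotient.nontrivial_iff.mpr fun h ↦
    (maximalIdeal.isMaximal R).ne_top (top_le_iff.mp (h ▸ (Ideal.span_singleton_le_iff_mem _).mpr hx))
  exact .of_surjective' _ Ideal.Quotient.mk_surjective

lemma spanFinrank_maximalIdeal_quotient_lt {R : Type*} [CommRing R] [IsLocalRing R]
    [IsNoetherianRing R] {x : R} (hx : x ∈ maximalIdeal R) (hx2 : x ∉ maximalIdeal R ^ 2)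
    [IsLocalRing (R ⧸ Ideal.span {x})] :
    (maximalIdeal (R ⧸ Ideal.span {x})).spanFinrank < (maximalIdeal R).spanFinrank := by
  classical
  obtain ⟨t, ht, hspan⟩ := exists_span_insert_eq_maximalIdeal hx hx2
  have h : maximalIdeal (R ⧸ Ideal.span {x}) =
      Ideal.span ((t.image (Ideal.Quotient.mk (Ideal.span {x})) : Finset _) : Set _) := by
    have : (maximalIdeal R).map (Ideal.Quotient.mk (Ideal.span {x})) =
        maximalIdeal (R ⧸ Ideal.span {x}) :=
      map_maximalIdeal_of_surjective _ Ideal.Quotient.mk_surjective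
    rw [← this, ← hspan, Ideal.map_span, Set.image_insert_eq, Finset.coe_image,
      Ideal.Quotient.eq_zero_iff_mem.mpr (Ideal.mem_span_singleton_self x), Ideal.span_insert,
      Ideal.span_singleton_eq_bot.mpr rfl, bot_sup_eq]
  rw [h]
  refine (Submodule.spanFinrank_span_le_ncard_of_finite (Finset.finite_toSet _)).trans_lt ?_
  rw [Set.ncard_coe_finset]
  exact Finset.card_image_le.trans_lt ht

/-- Killing `x` lowers the embedding dimension by at least one and the Krull dimension by at most
one. -/
lemma quotient_span_singleton {R : Type*} [CommRing R] [IsRegularLocalRing R] {x : R}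
    (hx : x ∈ maximalIdeal R) (hx2 : x ∉ maximalIdeal R ^ 2) :
    IsRegularLocalRing (R ⧸ Ideal.span {x}) := by
  have := isLocalRing_quotient_span_singleton hx
  refine of_spanFinrank_maximalIdeal_le _ ?_
  have h1 := spanFinrank_maximalIdeal_quotient_lt hx hx2
  have h2 : ringKrullDim R ≤ ringKrullDim (R ⧸ Ideal.span {x}) + 1 := by
    have := ringKrullDim_le_ringKrullDim_quotient_add_card (R := R) {x} (by
      simpa [ringJacobson_eq_maximalIdeal] using hx)
    rwa [Finset.card_singleton, Finset.coe_singleton, Nat.cast_one] at this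
  rw [← spanFinrank_maximalIdeal] at h2
  generalize ringKrullDim (R ⧸ Ideal.span {x}) = d at *
  have h3 : (((maximalIdeal (R ⧸ Ideal.span {x})).spanFinrank + 1 : ℕ) : WithBot ℕ∞) ≤ d + 1 :=
    le_trans (by exact_mod_cast h1) h2
  push_cast at h3
  exact ENat.WithBot.add_le_add_one_right_iff.mp h3

lemma not_maximalIdeal_le_sq {R : Type*} [CommRing R] [IsLocalRing R] [IsNoetherianRing R]
    (h : maximalIdeal R ≠ ⊥) : ¬ maximalIdeal R ≤ maximalIdeal R ^ 2 := fun hle ↦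
  h (Submodule.eq_bot_of_le_smul_of_le_jacobson_bot (maximalIdeal R) _
    (maximalIdeal R).fg_of_isNoetherianRing (by rwa [smul_eq_mul, ← pow_two])
    (jacobson_eq_maximalIdeal ⊥ bot_ne_top).ge)

/-- Induction on the embedding dimension. Choose `x` in the maximal ideal, outside its square and
outside all minimal primes; by induction `(x)` is prime. A minimal prime `p ⊆ (x)` not containing
`x` satisfies `p = x p`, so it vanishes by Nakayama. -/
theorem isDomain (R : Type*) [CommRing R] [IsRegularLocalRing R] : IsDomain R := by
  induction hn : (maximalIdeal R).spanFinrank using Nat.strong_induction_on generalizing R with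
  | _ n ih =>
  by_cases hbot : maximalIdeal R = ⊥
  · exact (isField_iff_maximalIdeal_eq.mpr hbot).isDomain
  have hdim : ringKrullDim R ≠ 0 := by
    rw [← spanFinrank_maximalIdeal]
    intro h
    exact hbot ((Submodule.spanFinrank_eq_zero_iff_eq_bot
      (maximalIdeal R).fg_of_isNoetherianRing).mp (by exact_mod_cast h))
  have hmin : ∀ p ∈ minimalPrimes R, ¬ maximalIdeal R ≤ p := by
    intro p hp hle
    have hpm : p = maximalIdeal R :=
      le_antisymm (le_maximalIdeal hp.1.1.ne_top) hle
    apply hdim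
    rw [← maximalIdeal_height_eq_ringKrullDim, ← hpm]
    have := hp.1.1
    rw [Ideal.height_eq_zero_iff.mpr hp]
    rfl
  have hsq : ¬ maximalIdeal R ≤ maximalIdeal R ^ 2 := not_maximalIdeal_le_sq hbot
  obtain ⟨x, hx, hx2, hxmin⟩ : ∃ x ∈ maximalIdeal R, x ∉ maximalIdeal R ^ 2 ∧
      ∀ p ∈ minimalPrimes R, x ∉ p := by
    by_contra! h
    -- Prime avoidance tolerates two non-prime ideals; the square of the maximal ideal fills both
    -- slots.
    have hcover := (Ideal.subset_union_prime_finite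
      (s := insert (maximalIdeal R ^ 2) (minimalPrimes R))
      ((minimalPrimes.finite_of_isNoetherianRing R).insert _) (f := id)
      (maximalIdeal R ^ 2) (maximalIdeal R ^ 2) (fun p hp hne _ ↦
        (hp.resolve_left hne).1.1) (I := maximalIdeal R)).mp (by
          intro y hy
          by_cases hy2 : y ∈ maximalIdeal R ^ 2
          · exact Set.mem_biUnion (Set.mem_insert _ _) hy2
          · obtain ⟨p, hp, hyp⟩ := h y hy hy2
            exact Set.mem_biUnion (Set.mem_insert_of_mem _ hp) hyp)
    obtain ⟨p, rfl | hp, hle⟩ := hcover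
    · exact hsq hle
    · exact hmin p hp hle
  have := quotient_span_singleton hx hx2
  have hdom : IsDomain (R ⧸ Ideal.span {x}) :=
    ih _ (hn ▸ spanFinrank_maximalIdeal_quotient_lt hx hx2) _ rfl
  have hprime : (Ideal.span {x}).IsPrime := (Ideal.Quotient.isDomain_iff_prime _).mp hdom
  obtain ⟨p, hp, hpx⟩ := Ideal.exists_minimalPrimes_le (I := ⊥) (J := Ideal.span {x}) bot_le
  have hpp : p.IsPrime := hp.1.1
  have hpbot : p = ⊥ := by
    refine Submodule.eq_bot_of_le_smul_of_le_jacobson_bot (Ideal.span {x}) _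
      p.fg_of_isNoetherianRing (fun y hy ↦ ?_)
      (((Ideal.span_singleton_le_iff_mem _).mpr hx).trans
        (jacobson_eq_maximalIdeal ⊥ bot_ne_top).ge)
    obtain ⟨z, rfl⟩ := Ideal.mem_span_singleton'.mp (hpx hy)
    have hz : z ∈ p := (hpp.mem_or_mem hy).resolve_right (hxmin p hp)
    rw [mul_comm]
    exact Ideal.mul_mem_mul (Ideal.mem_span_singleton_self x) hz
  have : (⊥ : Ideal R).IsPrime := hpbot ▸ hpp
  exact IsDomain.of_bot_isPrime R


/-! ### Algebraic extensions inside the fraction field of a regular local ring -/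

lemma isDiscreteValuationRing_localization_span_singleton {B : Type*} [CommRing B] [IsDomain B]
    [IsNoetherianRing B] {x : B} (hx : x ≠ 0) [(Ideal.span {x}).IsPrime] :
    IsDiscreteValuationRing (Localization.AtPrime (Ideal.span {x})) := by
  have hM : maximalIdeal (Localization.AtPrime (Ideal.span {x})) =
      Ideal.span {algebraMap B _ x} := by
    rw [← Localization.AtPrime.map_eq_maximalIdeal, Ideal.map_span, Set.image_singleton]
  have hinj : Function.Injective (algebraMap B (Localization.AtPrime (Ideal.span {x}))) :=
    IsLocalization.injective _ (Ideal.primeCompl_le_nonZeroDivisors (Ideal.span {x}))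
  have hnf : ¬ IsField (Localization.AtPrime (Ideal.span {x})) := by
    rw [isField_iff_maximalIdeal_eq, hM, Ideal.span_singleton_eq_bot]
    exact (map_ne_zero_iff _ hinj).mpr hx
  have h : (maximalIdeal (Localization.AtPrime (Ideal.span {x}))).IsPrincipal := ⟨_, hM⟩
  exact ((IsDiscreteValuationRing.TFAE _ hnf).out 0 4).mpr h

/-- Inside the fraction field of `A`, the image of `L` is integral over `k`, hence contained in `A`.
-/
lemma nonempty_algHom_of_isIntegrallyClosed {k L B F A : Type*} [Field k] [Field L] [Field F]
    [CommRing B] [CommRing A] [IsDomain A] [IsIntegrallyClosed A] [Algebra k L]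
    [Algebra.IsAlgebraic k L] [Algebra k B] [Algebra k A] [Algebra B A] [IsScalarTower k B A]
    [Algebra B F] [IsFractionRing B F] [Algebra k F] [IsScalarTower k B F]
    (hBA : Function.Injective (algebraMap B A)) (j : L →ₐ[k] F) : Nonempty (L →ₐ[k] A) := by
  let G := FractionRing A
  have hAG : Function.Injective (algebraMap A G) := IsFractionRing.injective A G
  have hBG : Function.Injective (algebraMap B G) := by
    rw [IsScalarTower.algebraMap_eq B A G]
    exact hAG.comp hBA
  have : IsScalarTower k B G := .of_algebraMap_eq fun a ↦ by
    rw [IsScalarTower.algebraMap_apply B A G, ← IsScalarTower.algebraMap_apply k B A,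
      ← IsScalarTower.algebraMap_apply k A G]
  let l : F →ₐ[k] G := (IsFractionRing.liftAlgHom (g := Algebra.ofId B G) hBG).restrictScalars k
  let j' : L →ₐ[k] G := l.comp j
  have hj' (a : L) : j' a ∈ (IsScalarTower.toAlgHom k A G).range := by
    have : IsIntegral A (j' a) :=
      ((Algebra.IsIntegral.isIntegral (R := k) a).map j').tower_top
    exact IsIntegrallyClosed.isIntegral_iff.mp this
  let e : A ≃ₐ[k] (IsScalarTower.toAlgHom k A G).range := AlgEquiv.ofInjective _ hAG
  exact ⟨e.symm.toAlgHom.comp (j'.codRestrict _ hj')⟩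

/-- If `B` is a regular local ring containing a field `k`, with fraction field `F`, then every
algebraic extension of `k` that embeds in `F` also embeds in the residue field of `B`. -/
theorem nonempty_algHom_of_algHom_fractionRing {k L E : Type*} {B F : Type u} [Field k] [Field L]
    [Field E] [Field F] [CommRing B] [IsRegularLocalRing B] [Algebra k L] [Algebra.IsAlgebraic k L]
    [Algebra k B] [Algebra k E] [Algebra B F] [IsFractionRing B F] [Algebra k F]
    [IsScalarTower k B F] (σ : B →ₐ[k] E) (hσ : ∀ b, IsUnit (σ b) → IsUnit b) (j : L →ₐ[k] F) :
    Nonempty (L →ₐ[k] E) := by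
  induction hn : (maximalIdeal B).spanFinrank using Nat.strong_induction_on generalizing B F with
  | _ n ih =>
  have := isDomain B
  by_cases hbot : maximalIdeal B = ⊥
  · have hs : Function.Surjective (algebraMap B F) :=
      (IsFractionRing.surjective_iff_isField (R := B) (K := F)).mpr
        (isField_iff_maximalIdeal_eq.mpr hbot)
    let e : B ≃ₐ[k] F := AlgEquiv.ofBijective (IsScalarTower.toAlgHom k B F)
      ⟨IsFractionRing.injective B F, hs⟩
    exact ⟨(σ.comp e.symm.toAlgHom).comp j⟩
  obtain ⟨x, hx, hx2⟩ := SetLike.not_le_iff_exists.mp (not_maximalIdeal_le_sq hbot)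
  have hx0 : x ≠ 0 := by rintro rfl; exact hx2 (zero_mem _)
  have := quotient_span_singleton hx hx2
  have hprime : (Ideal.span {x}).IsPrime :=
    (Ideal.Quotient.isDomain_iff_prime _).mp (isDomain _)
  have := isDiscreteValuationRing_localization_span_singleton hx0
  -- `L` lands in the DVR `B_(x)`, whose residue field is the fraction field of the smaller regular
  -- ring `B/(x)`.
  obtain ⟨j'⟩ := nonempty_algHom_of_isIntegrallyClosed (A := Localization.AtPrime (Ideal.span {x}))
    (IsLocalization.injective _ (Ideal.primeCompl_le_nonZeroDivisors (Ideal.span {x}))) j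
  have hσx : ∀ a ∈ Ideal.span {x}, σ a = 0 := fun a ha ↦ by
    by_contra h
    exact (((Ideal.span_singleton_le_iff_mem _).mpr hx) ha) (hσ a (isUnit_iff_ne_zero.mpr h))
  refine ih _ (hn ▸ spanFinrank_maximalIdeal_quotient_lt hx hx2)
    (F := (Ideal.span {x}).ResidueField)
    (Ideal.Quotient.liftₐ (Ideal.span {x}) σ hσx) (fun b hb ↦ ?_)
    ((IsScalarTower.toAlgHom k _ _).comp j') rfl
  obtain ⟨b, rfl⟩ := Ideal.Quotient.mk_surjective b
  exact (hσ b hb).map _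

end IsRegularLocalRing

/-! ### Stalks of schemes over an affine base -/

noncomputable section

namespace AlgebraicGeometry.Scheme

open IsLocalRing

section StalkStructureMap

variable {X Y Z : Scheme.{u}} {R S : CommRingCat.{u}}

/-- The ring homomorphism `R ⟶ 𝒪_{Y, y}` of an `R`-scheme `Y`. -/
def stalkStructureMap (f : Y ⟶ Spec R) (y : Y) : R ⟶ Y.presheaf.stalk y :=
  Spec.preimage (Y.fromSpecStalk y ≫ f)

lemma SpecMap_stalkStructureMap (f : Y ⟶ Spec R) (y : Y) :
    Spec.map (stalkStructureMap f y) = Y.fromSpecStalk y ≫ f :=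
  Spec.map_preimage _

lemma stalkStructureMap_comp_eq {f : Y ⟶ Spec R} {y : Y} {T : CommRingCat.{u}}
    {φ : Y.presheaf.stalk y ⟶ T} {ψ : R ⟶ T}
    (h : Spec.map φ ≫ Y.fromSpecStalk y ≫ f = Spec.map ψ) : stalkStructureMap f y ≫ φ = ψ :=
  Spec.map_injective (by rw [Spec.map_comp, SpecMap_stalkStructureMap, h])

lemma stalkStructureMap_stalkMap {i : X ⟶ Y} {f : Y ⟶ Spec R} {p : X ⟶ Spec S} {g : R ⟶ S}
    (h : i ≫ f = p ≫ Spec.map g) (x : X) :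
    stalkStructureMap f (i x) ≫ i.stalkMap x = g ≫ stalkStructureMap p x :=
  stalkStructureMap_comp_eq (by
    rw [SpecMap_stalkMap_fromSpecStalk_assoc, h, Spec.map_comp, reassoc_of% (SpecMap_stalkStructureMap p x)])

lemma stalkStructureMap_stalkSpecializes (f : Y ⟶ Spec R) {x y : Y} (h : x ⤳ y) :
    stalkStructureMap f y ≫ Y.presheaf.stalkSpecializes h = stalkStructureMap f x :=
  stalkStructureMap_comp_eq (by
    rw [SpecMap_stalkSpecializes_fromSpecStalk_assoc, SpecMap_stalkStructureMap])

lemma preimage_fromSpecResidueField (f : Y ⟶ Spec R) (y : Y) :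
    Spec.preimage (Y.fromSpecResidueField y ≫ f) = stalkStructureMap f y ≫ Y.residue y :=
  (stalkStructureMap_comp_eq (by
    rw [Spec.map_preimage, fromSpecResidueField, Category.assoc])).symm

lemma exists_stalk_hom_of_local {B : CommRingCat.{u}} [IsLocalRing B] (l : Spec B ⟶ X) {x : X}
    (h : l (closedPoint B) = x) :
    ∃ φ : X.presheaf.stalk x ⟶ B, IsLocalHom φ.hom ∧ Spec.map φ ≫ X.fromSpecStalk x = l := by
  subst h
  exact ⟨stalkClosedPointTo l, inferInstance, Spec_stalkClosedPointTo_fromSpecStalk l⟩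

end StalkStructureMap

/-- For a closed subscheme `X = Y ×_R S` with `S` a quotient of `R`, the kernel of
`𝒪_{Y, i(x)} ⟶ 𝒪_{X, x}` is generated by the kernel of `R ⟶ S`. -/
theorem ker_stalkMap_of_isPullback {X Y : Scheme.{u}} {R S : CommRingCat.{u}} {i : X ⟶ Y}
    {p : X ⟶ Spec S} {f : Y ⟶ Spec R} {g : R ⟶ S} (h : IsPullback i p f (Spec.map g))
    (hg : Function.Surjective g.hom) (x : X) :
    RingHom.ker (i.stalkMap x).hom =
      (RingHom.ker g.hom).map (stalkStructureMap f (i x)).hom := by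
  have : IsClosedImmersion (Spec.map g) := .spec_of_surjective g hg
  have : IsClosedImmersion i := MorphismProperty.of_isPullback h.flip this
  set J := (RingHom.ker g.hom).map (stalkStructureMap f (i x)).hom with hJ
  have hle : J ≤ RingHom.ker (i.stalkMap x).hom := by
    rw [hJ, Ideal.map_le_iff_le_comap]
    intro r hr
    have := congr($(stalkStructureMap_stalkMap h.w x).hom r)
    simp only [CommRingCat.hom_comp, RingHom.comp_apply] at this
    rw [Ideal.mem_comap, RingHom.mem_ker, this, RingHom.mem_ker.mp hr, map_zero]
  refine le_antisymm ?_ hle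
  have hJtop : J ≠ ⊤ := fun hJ ↦
    RingHom.ker_ne_top (i.stalkMap x).hom (top_le_iff.mp (hJ ▸ hle))
  let B : CommRingCat.{u} := .of (Y.presheaf.stalk (i x) ⧸ J)
  let q : Y.presheaf.stalk (i x) ⟶ B := CommRingCat.ofHom (Ideal.Quotient.mk J)
  have hq : Function.Surjective q.hom := Ideal.Quotient.mk_surjective
  have : Nontrivial B := Ideal.Quotient.nontrivial_iff.mpr hJtop
  have : IsLocalRing B := .of_surjective' q.hom hq
  have : IsLocalHom q.hom := .of_surjective q.hom hq
  have hker : ∀ r ∈ RingHom.ker g.hom, (stalkStructureMap f (i x) ≫ q).hom r = 0 := fun r hr ↦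
    Ideal.Quotient.eq_zero_iff_mem.mpr (Ideal.mem_map_of_mem _ hr)
  let a : S ⟶ B := CommRingCat.ofHom
    ((RingHom.liftOfSurjective g.hom hg) ⟨(stalkStructureMap f (i x) ≫ q).hom, hker⟩)
  have ha : g ≫ a = stalkStructureMap f (i x) ≫ q := by
    ext r
    exact RingHom.liftOfSurjective_comp_apply g.hom hg
      ⟨(stalkStructureMap f (i x) ≫ q).hom, hker⟩ r
  -- The quotient by `J` defines a point of the fibre product over `x`, so `q` factors through the
  -- stalk of `X` at `x`; this bounds the kernel by `J`.
  let l : Spec B ⟶ X := h.lift (Spec.map q ≫ Y.fromSpecStalk (i x)) (Spec.map a) (by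
    rw [Category.assoc, ← SpecMap_stalkStructureMap, ← Spec.map_comp, ← Spec.map_comp, ha])
  have hl : l ≫ i = Spec.map q ≫ Y.fromSpecStalk (i x) := h.lift_fst _ _ _
  have hlx : l (closedPoint B) = x := by
    apply i.isClosedEmbedding.injective
    have h1 : (l ≫ i) (closedPoint B) = i (l (closedPoint B)) := Hom.comp_apply _ _ _
    have h2 : (Spec.map q ≫ Y.fromSpecStalk (i x)) (closedPoint B) =
        Y.fromSpecStalk (i x) (closedPoint (Y.presheaf.stalk (i x))) :=
      congr(Y.fromSpecStalk (i x) $(Spec_closedPoint (f := q)))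
    exact h1.symm.trans (congr($hl (closedPoint B)) |>.trans (h2.trans fromSpecStalk_closedPoint))
  obtain ⟨φ, -, hφ⟩ := exists_stalk_hom_of_local l hlx
  have hfac : i.stalkMap x ≫ φ = q := by
    apply Spec.map_injective
    rw [← cancel_mono (Y.fromSpecStalk (i x)), Spec.map_comp, Category.assoc,
      SpecMap_stalkMap_fromSpecStalk, reassoc_of% hφ, hl]
  intro b hb
  have : q.hom b = 0 := by
    rw [← hfac, CommRingCat.hom_comp, RingHom.comp_apply, RingHom.mem_ker.mp hb, map_zero]
  exact Ideal.Quotient.eq_zero_iff_mem.mp this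

/-- If the local ring at `x` is a domain, then the local ring at the most general generalization
of `x` is its field of fractions. -/
theorem isFractionRing_stalk_of_forall_specializes {X : Scheme.{u}} {x ξ : X}
    [IsDomain (X.presheaf.stalk x)] (h : ξ ⤳ x) (hξ : ∀ y : X, y ⤳ x → ξ ⤳ y) :
    letI := (X.presheaf.stalkSpecializes h).hom.toAlgebra
    IsFractionRing (X.presheaf.stalk x) (X.presheaf.stalk ξ) := by
  let B := X.presheaf.stalk x
  let F : CommRingCat.{u} := .of (FractionRing B)
  let c : B ⟶ F := CommRingCat.ofHom (algebraMap B (FractionRing B))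
  have hF : IsLocalRing F := inferInstanceAs (IsLocalRing (FractionRing B))
  -- The spectrum of the fraction field hits `ξ`, which gives a local map `φ` from the stalk at `ξ`
  -- to `F`; the localization property gives its inverse `θ`.
  have hl : (Spec.map c ≫ X.fromSpecStalk x) (closedPoint F) = ξ := by
    have h1 : (Spec.map c ≫ X.fromSpecStalk x) (closedPoint F) =
      X.fromSpecStalk x (Spec.map c (closedPoint F)) := Hom.comp_apply _ _ _
    obtain ⟨z, hz⟩ : ξ ∈ Set.range (X.fromSpecStalk x) := range_fromSpecStalk.ge h
    have h2 : Spec.map c (closedPoint F) ⤳ z := by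
      refine (PrimeSpectrum.le_iff_specializes _ _).mp fun b hb ↦ ?_
      have hb : algebraMap B (FractionRing B) b ∈ maximalIdeal (FractionRing B) := hb
      have : b = 0 := by
        rw [maximalIdeal_eq_bot, Ideal.mem_bot] at hb
        exact (map_eq_zero_iff _ (IsFractionRing.injective B (FractionRing B))).mp hb
      exact this ▸ zero_mem _
    rw [h1]
    refine (Specializes.antisymm (hz ▸ h2.map (X.fromSpecStalk x).continuous) (hξ _ ?_)).eq
    exact range_fromSpecStalk.le ⟨_, rfl⟩
  obtain ⟨φ, hφl, hφ⟩ := exists_stalk_hom_of_local _ hl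
  have h1 : X.presheaf.stalkSpecializes h ≫ φ = c := by
    apply Spec.map_injective
    rw [← cancel_mono (X.fromSpecStalk x), Spec.map_comp, Category.assoc,
      SpecMap_stalkSpecializes_fromSpecStalk, hφ]
  have hu (b : nonZeroDivisors B) : IsUnit ((X.presheaf.stalkSpecializes h).hom b) := by
    have : IsUnit (φ.hom ((X.presheaf.stalkSpecializes h).hom b)) := by
      rw [← RingHom.comp_apply, ← CommRingCat.hom_comp, h1]
      exact IsLocalization.map_units (FractionRing B) b
    exact isUnit_of_map_unit φ.hom _ this
  let θ : F ⟶ X.presheaf.stalk ξ := CommRingCat.ofHom (IsLocalization.lift hu)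
  have h2 : c ≫ θ = X.presheaf.stalkSpecializes h := by
    ext b
    exact IsLocalization.lift_eq hu b
  have h3 : φ ≫ θ = 𝟙 _ := by
    apply Spec.map_injective
    rw [← cancel_mono (X.fromSpecStalk ξ), Spec.map_comp, Category.assoc, hφ,
      ← Spec.map_comp_assoc, h2, SpecMap_stalkSpecializes_fromSpecStalk, Spec.map_id,
      Category.id_comp]
  have h4 : Function.Surjective θ.hom := fun a ↦ ⟨φ.hom a, congr($(h3).hom a)⟩
  let alg := (X.presheaf.stalkSpecializes h).hom.toAlgebra
  let e : FractionRing B ≃ₐ[B] X.presheaf.stalk ξ :=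
    AlgEquiv.ofBijective (AlgHom.mk θ.hom fun b ↦ congr($(h2).hom b))
      ⟨RingHom.injective (R := FractionRing B) θ.hom, h4⟩
  exact IsLocalization.isLocalization_of_algEquiv _ e

end AlgebraicGeometry.Scheme

/-! ### The generic fibre and points in the function field -/

namespace DVRFibres

open Scheme

lemma isGenericPoint_componentGenericPoint {X : Scheme.{u}} (C : irreducibleComponents X) :
    IsGenericPoint (componentGenericPoint C) (C : Set X) :=
  C.2.1.isGenericPoint_genericPoint (isClosed_of_mem_irreducibleComponents _ C.2)

lemma componentGenericPoint_specializes {X : Scheme.{u}} {C : irreducibleComponents X} {x : X}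
    (hx : x ∈ (C : Set X)) : componentGenericPoint C ⤳ x :=
  (isGenericPoint_componentGenericPoint C).specializes hx

/-- The projection `Y ×_R A ⟶ Y`. -/
def baseChangeFst {R : Type u} [CommRing R] {Y : Scheme.{u}} (f : Y ⟶ Spec (.of R))
    (A : Type u) [CommRing A] [Algebra R A] : baseChange f A ⟶ Y :=
  pullback.fst f (Spec.map (CommRingCat.ofHom (algebraMap R A)))

lemma isPullback_baseChange {R : Type u} [CommRing R] {Y : Scheme.{u}} (f : Y ⟶ Spec (.of R))
    (A : Type u) [CommRing A] [Algebra R A] :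
    IsPullback (baseChangeFst f A) (baseChangeHom f A) f
      (Spec.map (CommRingCat.ofHom (algebraMap R A))) :=
  IsPullback.of_hasPullback _ _

/-- At a point coming from the generic fibre, `R` injects because it injects into `K`. The function
field transfers this to every point, since the structure map to it factors through each stalk. -/
lemma injective_stalkStructureMap {R K : Type u} [CommRing R] [Field K] [Algebra R K]
    [FaithfulSMul R K] {Y : Scheme.{u}} [IsIntegral Y] (f : Y ⟶ Spec (.of R))
    [Nonempty (baseChange f K)] (y : Y) :
    Function.Injective (stalkStructureMap f y).hom := by
  obtain ⟨t⟩ := ‹Nonempty (baseChange f K)›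
  let i := baseChangeFst f K
  have h1 := stalkStructureMap_stalkMap (isPullback_baseChange f K).w t
  have hit : Function.Injective (stalkStructureMap f (i t)).hom := by
    rw [injective_iff_map_eq_zero]
    intro r hr
    have h2 := congr($(h1).hom r)
    simp only [CommRingCat.hom_comp, RingHom.comp_apply] at h2
    erw [hr] at h2
    rw [map_zero, eq_comm] at h2
    have h3 := (map_eq_zero_iff _ (RingHom.injective (R := K)
      (stalkStructureMap (baseChangeHom f K) t).hom)).mp h2
    exact (map_eq_zero_iff _ (FaithfulSMul.algebraMap_injective R K)).mp h3
  have hgen : Function.Injective (stalkStructureMap f (genericPoint Y)).hom := by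
    rw [← stalkStructureMap_stalkSpecializes f (genericPoint_specializes (i t)),
      CommRingCat.hom_comp]
    exact (IsFractionRing.injective (Y.presheaf.stalk (i t)) Y.functionField).comp hit
  rw [← stalkStructureMap_stalkSpecializes f (genericPoint_specializes y),
    CommRingCat.hom_comp] at hgen
  exact .of_comp hgen

/-- A rational map between the generic fibres gives a point of the target with values in the
function field of the source. -/
theorem exists_functionField_point {R K : Type u} [CommRing R] [IsDomain R] [Field K] [Algebra R K]
    [IsFractionRing R K] {Y Y' : Scheme.{u}} [IsIntegral Y] (f : Y ⟶ Spec (.of R))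
    (f' : Y' ⟶ Spec (.of R)) [Nonempty (baseChange f K)]
    (φ : (baseChange f K).RationalMap (baseChange f' K))
    (hφ : φ.compHom (baseChangeHom f' K) = (baseChangeHom f K).toRationalMap) :
    ∃ h : Spec Y.functionField ⟶ Y', h ≫ f' = Y.fromSpecStalk (genericPoint Y) ≫ f := by
  have := IsPreimmersion.of_isLocalization (R := R) (S := K) (nonZeroDivisors R)
  let c := CommRingCat.ofHom (algebraMap R K)
  let i := baseChangeFst f K
  have : IsPreimmersion i := inferInstanceAs (IsPreimmersion (pullback.fst f (Spec.map c)))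
  have hinj := injective_stalkStructureMap (K := K) f (genericPoint Y)
  let g : CommRingCat.of K ⟶ Y.functionField := CommRingCat.ofHom (IsFractionRing.lift hinj)
  have hg : c ≫ g = stalkStructureMap f (genericPoint Y) := by
    ext r
    exact IsFractionRing.lift_algebraMap hinj r
  let s : Spec Y.functionField ⟶ baseChange f K :=
    (isPullback_baseChange f K).lift (Y.fromSpecStalk (genericPoint Y)) (Spec.map g) (by
      rw [← SpecMap_stalkStructureMap, ← Spec.map_comp, hg])
  have hs : s ≫ i = Y.fromSpecStalk (genericPoint Y) := (isPullback_baseChange f K).lift_fst _ _ _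
  -- The image of `s` specializes to every point, so it lies in every non-empty open set, in
  -- particular in the domain of a representative of `φ`.
  have hsgen (z : Spec Y.functionField) (t : baseChange f K) : s z ⤳ t := by
    rw [← i.isEmbedding.isInducing.specializes_iff]
    have h1 : i (s z) = Y.fromSpecStalk (genericPoint Y) z :=
      (Hom.comp_apply _ _ _).symm.trans congr($hs z)
    have h2 : i (s z) ⤳ genericPoint Y := by
      rw [h1]; exact range_fromSpecStalk.le ⟨z, rfl⟩
    exact h2.trans (genericPoint_specializes _)
  obtain ⟨ψ, rfl⟩ := φ.exists_rep
  rw [← RationalMap.compHom_toRationalMap, PartialMap.toRationalMap_eq_iff] at hφ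
  obtain ⟨W, hW, hWl, hWr, e⟩ := hφ
  obtain ⟨w, hw⟩ := hW.nonempty
  let s' : Spec Y.functionField ⟶ W := IsOpenImmersion.lift W.ι s (by
    rintro _ ⟨z, rfl⟩
    simpa using (hsgen z w).mem_open W.2 hw)
  have hs' : s' ≫ W.ι = s := IsOpenImmersion.lift_fac _ _ _
  have hWl' : W ≤ ψ.domain := hWl
  let m : (W : Scheme) ⟶ baseChange f' K := (baseChange f K).homOfLE hWl' ≫ ψ.hom
  have hm : m ≫ baseChangeHom f' K = W.ι ≫ baseChangeHom f K := by
    have e' : (baseChange f K).homOfLE hWl' ≫ ψ.hom ≫ baseChangeHom f' K =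
      (baseChange f K).homOfLE (le_top : W ≤ ⊤) ≫ (⊤ : (baseChange f K).Opens).ι ≫
        baseChangeHom f K := e
    rw [Category.assoc, e', homOfLE_ι_assoc]
  refine ⟨s' ≫ m ≫ baseChangeFst f' K, ?_⟩
  rw [Category.assoc, Category.assoc, (isPullback_baseChange f' K).w, reassoc_of% hm,
    reassoc_of% hs', ← (isPullback_baseChange f K).w, reassoc_of% hs]

end DVRFibres

/-! ### Components through a point whose local ring is a domain -/

namespace DVRFibres

open Scheme IsLocalRing

lemma length_self_eq_one_iff_isField (A : Type*) [CommRing A] :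
    Module.length A A = 1 ↔ IsField A := by
  rw [Module.length_eq_one_iff, isSimpleModule_self_iff_isUnit]
  refine ⟨fun ⟨_, h⟩ ↦ ⟨exists_pair_ne A, mul_comm, fun ha ↦ (h _ ha).exists_right_inv⟩, fun h ↦
    ⟨h.nontrivial, fun a ha ↦ IsUnit.of_mul_eq_one _ (h.mul_inv_cancel ha).choose_spec⟩⟩

lemma exists_forall_specializes {X : Scheme.{u}} (x : X) [IsDomain (X.presheaf.stalk x)] :
    ∃ ξ : X, ξ ⤳ x ∧ ∀ y : X, y ⤳ x → ξ ⤳ y := by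
  let b : Spec (X.presheaf.stalk x) := (⟨⊥, Ideal.isPrime_bot⟩ : PrimeSpectrum _)
  refine ⟨X.fromSpecStalk x b, range_fromSpecStalk.le ⟨_, rfl⟩, fun y hy ↦ ?_⟩
  obtain ⟨z, rfl⟩ : y ∈ Set.range (X.fromSpecStalk x) := range_fromSpecStalk.ge hy
  have : b ⤳ z := (PrimeSpectrum.le_iff_specializes _ _).mp fun a (ha : a ∈ (⊥ : Ideal _)) ↦
    (Ideal.mem_bot.mp ha) ▸ zero_mem _
  exact this.map (X.fromSpecStalk x).continuous

/-- The zero ideal of the stalk gives a most general point `ξ` above `x`; its closure contains `C`,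
so equals `C` by maximality. -/
lemma componentGenericPoint_specializes_of_specializes {X : Scheme.{u}}
    {C : irreducibleComponents X} {x : X} [IsDomain (X.presheaf.stalk x)] (hx : x ∈ (C : Set X))
    {y : X} (hy : y ⤳ x) : componentGenericPoint C ⤳ y := by
  obtain ⟨ξ, -, hξ⟩ := exists_forall_specializes x
  have h1 : (C : Set X) ⊆ closure {ξ} := by
    rw [← (isGenericPoint_componentGenericPoint C).def]
    exact closure_minimal (Set.singleton_subset_iff.mpr
      (hξ _ (componentGenericPoint_specializes hx)).mem_closure) isClosed_closure
  have h2 : ξ ∈ (C : Set X) := C.2.2 isIrreducible_singleton.closure h1 (subset_closure rfl)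
  exact (componentGenericPoint_specializes h2).trans (hξ y hy)

lemma isField_stalk_componentGenericPoint {X : Scheme.{u}} {C : irreducibleComponents X} {x : X}
    (hx : x ∈ (C : Set X)) [IsDomain (X.presheaf.stalk x)] :
    IsField (X.presheaf.stalk (componentGenericPoint C)) := by
  let _ := (X.presheaf.stalkSpecializes (componentGenericPoint_specializes hx)).hom.toAlgebra
  have := isFractionRing_stalk_of_forall_specializes (componentGenericPoint_specializes hx)
    fun _ ↦ componentGenericPoint_specializes_of_specializes hx
  exact (IsFractionRing.toField (X.presheaf.stalk x)).toIsField

instance {X : Scheme.{u}} {k : Type u} [Field k] (p : X ⟶ Spec (.of k))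
    (C : irreducibleComponents X) : Algebra.IsAlgebraic k (constantField p C) :=
  inferInstanceAs (Algebra.IsAlgebraic k (algebraicClosure k (componentFunctionField p C)))

/-- If `x` is a regular point on `C`, then the field of constants of `C` maps to every
extension of `k` to which the residue field at `x` maps. -/
lemma nonempty_constantField_algHom {X : Scheme.{u}} {k : Type u} [Field k] (p : X ⟶ Spec (.of k))
    {C : irreducibleComponents X} {x : X} (hx : x ∈ (C : Set X))
    [IsRegularLocalRing (X.presheaf.stalk x)] {E : Type u} [Field E] [Algebra k E] (τ : X.presheaf.stalk x →+* E) [IsLocalHom τ]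
    (hτ : τ.comp (stalkStructureMap p x).hom = algebraMap k E) :
    Nonempty (constantField p C →ₐ[k] E) := by
  have := IsRegularLocalRing.isDomain (X.presheaf.stalk x)
  let ξ := componentGenericPoint C
  have hs : ξ ⤳ x := componentGenericPoint_specializes hx
  let _ := (X.presheaf.stalkSpecializes hs).hom.toAlgebra
  have := isFractionRing_stalk_of_forall_specializes hs
    fun _ ↦ componentGenericPoint_specializes_of_specializes hx
  let _ : Algebra k (X.presheaf.stalk x) := (stalkStructureMap p x).hom.toAlgebra
  let _ : Algebra (X.presheaf.stalk x) (componentFunctionField p C) :=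
    (X.presheaf.stalkSpecializes hs ≫ X.residue ξ).hom.toAlgebra
  have : IsScalarTower k (X.presheaf.stalk x) (componentFunctionField p C) :=
    .of_algebraMap_eq fun a ↦ by
      have h1 : Spec.preimage (X.fromSpecResidueField ξ ≫ p) =
          stalkStructureMap p x ≫ X.presheaf.stalkSpecializes hs ≫ X.residue ξ := by
        rw [preimage_fromSpecResidueField, ← stalkStructureMap_stalkSpecializes p hs,
          Category.assoc]
      exact congr($(h1).hom a)
  -- The stalk at `ξ` is already a field, so `k(C)` is the fraction field of the stalk at `x`.
  have hinj : Function.Injective (X.residue ξ).hom := by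
    let _ := (isField_stalk_componentGenericPoint hx).toField
    exact RingHom.injective (R := X.presheaf.stalk (componentGenericPoint C)) (X.residue ξ).hom
  let e : X.presheaf.stalk ξ ≃ₐ[X.presheaf.stalk x] componentFunctionField p C :=
    AlgEquiv.ofBijective (AlgHom.mk (X.residue ξ).hom fun _ ↦ rfl)
      ⟨hinj, X.residue_surjective ξ⟩
  have : IsFractionRing (X.presheaf.stalk x) (componentFunctionField p C) :=
    IsLocalization.isLocalization_of_algEquiv _ e
  exact IsRegularLocalRing.nonempty_algHom_of_algHom_fractionRing
    (AlgHom.mk τ fun a ↦ congr($hτ a)) (fun b hb ↦ isUnit_of_map_unit τ b hb)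
    (constantField p C).val

lemma _root_.AlgHom.nonempty_algebraicClosure {k L E : Type*} [Field k] [Field L] [Field E]
    [Algebra k L] [Algebra k E] [Algebra.IsAlgebraic k L] (j : L →ₐ[k] E) :
    Nonempty (L →ₐ[k] algebraicClosure k E) :=
  ⟨j.codRestrict (algebraicClosure k E).toSubalgebra fun a ↦ mem_algebraicClosure_iff.mpr
    ((Algebra.IsAlgebraic.isAlgebraic (R := k) a).algHom j)⟩

/-! ### Local rings of the special fibre, and the valuative criterion -/

section SpecialFibre

variable {R : Type u} [CommRing R] [IsLocalRing R] {Y : Scheme.{u}} (f : Y ⟶ Spec (.of R))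

lemma ker_stalkMap_baseChangeFst {π : R} (hπ : maximalIdeal R = Ideal.span {π})
    (x : baseChange f (ResidueField R)) :
    RingHom.ker ((baseChangeFst f (ResidueField R)).stalkMap x).hom =
      Ideal.span {(stalkStructureMap f (baseChangeFst f (ResidueField R) x)).hom π} := by
  rw [ker_stalkMap_of_isPullback (isPullback_baseChange f (ResidueField R)) residue_surjective,
    CommRingCat.hom_ofHom]
  erw [ker_residue]
  rw [hπ, Ideal.map_span, Set.image_singleton]

lemma surjective_stalkMap_baseChangeFst (x : baseChange f (ResidueField R)) :
    Function.Surjective ((baseChangeFst f (ResidueField R)).stalkMap x).hom := by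
  have : IsClosedImmersion
      (Spec.map (CommRingCat.ofHom (algebraMap R (ResidueField R)))) :=
    .spec_of_surjective _ residue_surjective
  have : IsClosedImmersion (baseChangeFst f (ResidueField R)) :=
    MorphismProperty.of_isPullback (isPullback_baseChange f _).flip this
  exact (baseChangeFst f (ResidueField R)).stalkMap_surjective x

lemma isRegularLocalRing_stalk_baseChange {π : R} (hπ : maximalIdeal R = Ideal.span {π})
    (x : baseChange f (ResidueField R))
    [IsRegularLocalRing (Y.presheaf.stalk (baseChangeFst f (ResidueField R) x))]
    (h1 : (stalkStructureMap f (baseChangeFst f (ResidueField R) x)).hom π ∈ maximalIdeal _)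
    (h2 : (stalkStructureMap f (baseChangeFst f (ResidueField R) x)).hom π ∉ maximalIdeal _ ^ 2) :
    IsRegularLocalRing ((baseChange f (ResidueField R)).presheaf.stalk x) := by
  have := IsRegularLocalRing.quotient_span_singleton h1 h2
  exact .of_ringEquiv ((Ideal.quotEquivOfEq (ker_stalkMap_baseChangeFst f hπ x).symm).trans
    (RingHom.quotientKerEquivOfSurjective (surjective_stalkMap_baseChangeFst f x)))

/-- On an integral regular scheme, the local ring at a component of multiplicity one of the special
fibre has `π` as uniformizer. -/
lemma maximalIdeal_stalk_baseChangeFst {π : R} (hπ : maximalIdeal R = Ideal.span {π})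
    {x : baseChange f (ResidueField R)}
    (hx : IsField ((baseChange f (ResidueField R)).presheaf.stalk x)) :
    maximalIdeal (Y.presheaf.stalk (baseChangeFst f (ResidueField R) x)) =
      Ideal.span {(stalkStructureMap f (baseChangeFst f (ResidueField R) x)).hom π} := by
  rw [← ker_stalkMap_baseChangeFst f hπ]
  let _ := hx.toField
  exact (eq_maximalIdeal (RingHom.ker_isMaximal_of_surjective _
    (surjective_stalkMap_baseChangeFst f x))).symm

end SpecialFibre

/-- The existence part of the valuative criterion. -/
lemma exists_lift_of_universallyClosed {X S : Scheme.{u}} (f : X ⟶ S) [UniversallyClosed f]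
    {A K : Type u} [CommRing A] [IsDomain A] [ValuationRing A] [Field K] [Algebra A K]
    [IsFractionRing A K] {a : Spec (.of K) ⟶ X} {b : Spec (.of A) ⟶ S}
    (h : a ≫ f = Spec.map (CommRingCat.ofHom (algebraMap A K)) ≫ b) :
    ∃ l : Spec (.of A) ⟶ X, l ≫ f = b := by
  have hex : ValuativeCriterion.Existence f := by
    have hf := ‹UniversallyClosed f›
    rw [UniversallyClosed.eq_valuativeCriterion] at hf
    exact hf.1
  let S' : ValuativeCommSq f := { R := A, K := K, i₁ := a, i₂ := b, commSq := ⟨h⟩ }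
  have := hex S'
  exact ⟨S'.commSq.lift, S'.commSq.fac_right⟩

/-- The valuative criterion at a point whose local ring is a valuation ring. -/
lemma exists_fromSpecStalk_lift {S Y Y' : Scheme.{u}} [IsIntegral Y] (f : Y ⟶ S) (f' : Y' ⟶ S)
    [UniversallyClosed f'] {h : Spec Y.functionField ⟶ Y'}
    (hh : h ≫ f' = Y.fromSpecStalk (genericPoint Y) ≫ f) (y : Y)
    [ValuationRing (Y.presheaf.stalk y)] :
    ∃ l : Spec (Y.presheaf.stalk y) ⟶ Y', l ≫ f' = Y.fromSpecStalk y ≫ f := by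
  let A := Y.presheaf.stalk y
  have hc : h ≫ f' = Spec.map (CommRingCat.ofHom (algebraMap A Y.functionField)) ≫
      Y.fromSpecStalk y ≫ f := by
    rw [hh, ← SpecMap_stalkSpecializes_fromSpecStalk (genericPoint_specializes y), Category.assoc]
    rfl
  exact exists_lift_of_universallyClosed (A := A) (K := Y.functionField) f' hc

end DVRFibres

end

/-! ### The theorem -/

open DVRFibres AlgebraicGeometry.Scheme IsLocalRing in
theorem proposition2p2
    {R : Type u} [CommRing R] [IsDomain R] [IsDiscreteValuationRing R]
    [PerfectField (IsLocalRing.ResidueField R)]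
    {K : Type u} [Field K] [Algebra R K] [IsFractionRing R K]
    {Y Y' : Scheme.{u}} [IsIntegral Y] [IsIntegral Y']
    (hY : DVRFibres.IsRegularScheme Y) (hY' : DVRFibres.IsRegularScheme Y')
    (f : Y ⟶ Spec (.of R)) (f' : Y' ⟶ Spec (.of R)) [IsProper f] [IsProper f']
    -- the generic fibre of `Y` is non-empty
    [Nonempty (DVRFibres.baseChange f K)]
    -- there is a dominant rational map of `K`-schemes between the generic fibres
    (hdom : ∃ φ : (DVRFibres.baseChange f K).RationalMap (DVRFibres.baseChange f' K),
      φ.IsDominant ∧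
      φ.compHom (DVRFibres.baseChangeHom f' K) = (DVRFibres.baseChangeHom f K).toRationalMap)
    (C : irreducibleComponents (DVRFibres.baseChange f (IsLocalRing.ResidueField R)))
    (hC : DVRFibres.componentMultiplicity C = 1) :
    ∃ C' : irreducibleComponents (DVRFibres.baseChange f' (IsLocalRing.ResidueField R)),
      DVRFibres.componentMultiplicity C' = 1 ∧
      Nonempty
        (DVRFibres.constantField
            (DVRFibres.baseChangeHom f' (IsLocalRing.ResidueField R)) C'
          →ₐ[IsLocalRing.ResidueField R]
        DVRFibres.constantField
            (DVRFibres.baseChangeHom f (IsLocalRing.ResidueField R)) C) := by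
  obtain ⟨φ, -, hφ⟩ := hdom
  obtain ⟨h, hh⟩ := exists_functionField_point f f' φ hφ
  obtain ⟨π, hπ⟩ := IsDiscreteValuationRing.exists_irreducible R
  have hspan : maximalIdeal R = Ideal.span {π} := hπ.maximalIdeal_eq
  let i := baseChangeFst f (ResidueField R)
  let p := baseChangeHom f (ResidueField R)
  let i' := baseChangeFst f' (ResidueField R)
  let p' := baseChangeHom f' (ResidueField R)
  let X := baseChange f (ResidueField R)
  let X' := baseChange f' (ResidueField R)
  let η : X := componentGenericPoint C
  let y : Y := i η
  let E := componentFunctionField p C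
  have hmax : maximalIdeal (Y.presheaf.stalk y) = Ideal.span {(stalkStructureMap f y).hom π} :=
    maximalIdeal_stalk_baseChangeFst f hspan ((length_self_eq_one_iff_isField _).mp hC)
  -- Non-emptiness of the generic fibre ensures that the stalk at `y` is not a field.
  have hπ0 : (stalkStructureMap f y).hom π ≠ 0 :=
    (map_ne_zero_iff _ (injective_stalkStructureMap (K := K) f y)).mpr hπ.ne_zero
  have hYy := hY.isRegularLocalRing_stalk y
  have hdvr : IsDiscreteValuationRing (Y.presheaf.stalk y) := by
    have hnf : ¬ IsField (Y.presheaf.stalk y) := by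
      rwa [isField_iff_maximalIdeal_eq, hmax, Ideal.span_singleton_eq_bot]
    have hprin : (maximalIdeal (Y.presheaf.stalk y)).IsPrincipal := ⟨_, hmax⟩
    exact ((IsDiscreteValuationRing.TFAE _ hnf).out 0 4).mpr hprin
  obtain ⟨l, hl⟩ := exists_fromSpecStalk_lift f f' hh y
  let q : Y.presheaf.stalk y ⟶ X.residueField η := i.stalkMap η ≫ X.residue η
  have hres : IsLocalHom (X.residue η).hom :=
    inferInstanceAs (IsLocalHom (IsLocalRing.residue (X.presheaf.stalk η)))
  have hq : IsLocalHom q.hom := RingHom.isLocalHom_comp (X.residue η).hom (i.stalkMap η).hom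
  -- Restricting `l` to the closed point gives a map into the special fibre of `Y'`.
  let m : Spec (X.residueField η) ⟶ X' := (isPullback_baseChange f' (ResidueField R)).lift
    (Spec.map q ≫ l) (X.fromSpecResidueField η ≫ p) (by
      rw [Category.assoc, hl, Spec.map_comp, Category.assoc,
        SpecMap_stalkMap_fromSpecStalk_assoc, (isPullback_baseChange f (ResidueField R)).w,
        Category.assoc, fromSpecResidueField, Category.assoc])
  have hmi : m ≫ i' = Spec.map q ≫ l := (isPullback_baseChange f' _).lift_fst _ _ _
  have hmp : m ≫ p' = X.fromSpecResidueField η ≫ p := (isPullback_baseChange f' _).lift_snd _ _ _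
  let x' : X' := m (closedPoint (X.residueField η))
  have hlx : l (closedPoint (Y.presheaf.stalk y)) = i' x' := by
    have h1 : i' x' = (Spec.map q ≫ l) (closedPoint (X.residueField η)) :=
      (Hom.comp_apply _ _ _).symm.trans congr($hmi (closedPoint (X.residueField η)))
    have h2 : (Spec.map q ≫ l) (closedPoint (X.residueField η)) =
        l (closedPoint (Y.presheaf.stalk y)) := congr(l $(Spec_closedPoint (f := q)))
    exact (h1.trans h2).symm
  obtain ⟨ψ, hψloc, hψ⟩ := exists_stalk_hom_of_local l hlx
  obtain ⟨τ, hτloc, hτ⟩ := exists_stalk_hom_of_local m (x := x') rfl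
  have hσψ : stalkStructureMap f' (i' x') ≫ ψ = stalkStructureMap f y :=
    stalkStructureMap_comp_eq (by rw [reassoc_of% hψ, hl, SpecMap_stalkStructureMap])
  have hστ : stalkStructureMap p' x' ≫ τ = Spec.preimage (X.fromSpecResidueField η ≫ p) :=
    stalkStructureMap_comp_eq (by rw [reassoc_of% hτ, hmp, Spec.map_preimage])
  have hψπ : ψ.hom ((stalkStructureMap f' (i' x')).hom π) = (stalkStructureMap f y).hom π :=
    congr($(hσψ).hom π)
  have hψm : (maximalIdeal (Y'.presheaf.stalk (i' x'))).map ψ.hom ≤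
      maximalIdeal (Y.presheaf.stalk y) := map_maximalIdeal_le ψ.hom
  have h1 : (stalkStructureMap f' (i' x')).hom π ∈ maximalIdeal (Y'.presheaf.stalk (i' x')) := by
    intro hunit
    have h3 : (stalkStructureMap f y).hom π ∈ maximalIdeal (Y.presheaf.stalk y) :=
      hmax ▸ Ideal.mem_span_singleton_self _
    exact h3 (hψπ ▸ hunit.map ψ.hom)
  -- Otherwise the local map `ψ` would put the uniformizer `π` of the stalk at `y` into the square
  -- of its maximal ideal.
  have h2 : (stalkStructureMap f' (i' x')).hom π ∉
      maximalIdeal (Y'.presheaf.stalk (i' x')) ^ 2 := by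
    intro hmem
    have h3 := Ideal.mem_map_of_mem ψ.hom hmem
    rw [hψπ, Ideal.map_pow] at h3
    refine IsRegularLocalRing.not_maximalIdeal_le_sq
      (IsDiscreteValuationRing.not_a_field (Y.presheaf.stalk y)) ?_
    conv_lhs => rw [hmax]
    exact (Ideal.span_singleton_le_iff_mem _).mpr (Ideal.pow_right_mono hψm 2 h3)
  have := hY'.isRegularLocalRing_stalk (i' x')
  have hreg : IsRegularLocalRing (X'.presheaf.stalk x') :=
    isRegularLocalRing_stalk_baseChange f' hspan x' h1 h2
  have := IsRegularLocalRing.isDomain (X'.presheaf.stalk x')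
  let C' : irreducibleComponents X' :=
    ⟨irreducibleComponent x', irreducibleComponent_mem_irreducibleComponents x'⟩
  have hx' : x' ∈ (C' : Set X') := mem_irreducibleComponent
  refine ⟨C', (length_self_eq_one_iff_isField _).mpr (isField_stalk_componentGenericPoint hx'), ?_⟩
  let τ' : X'.presheaf.stalk x' →+* E := τ.hom
  have : IsLocalHom τ' := hτloc
  obtain ⟨j⟩ := nonempty_constantField_algHom p' hx' τ' congr($(hστ).hom)
  exact j.nonempty_algebraicClosure
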